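/- Let $D([0,\infty):\mathbb{R}^k)$ be the space of càdlàg functions $[0,\infty)\to\mathbb{R}^k$, and let $D_\uparrow\subset D([0,\infty):\mathbb{R})$ be the set of non-decreasing, non-negative $y$ with $y(t)\to\infty$ as $t\to\infty$. Write $[a,b]=\{\lambda a+(1-\lambda)b:\lambda\in[0,1]\}$ for the line segment between $a,b\in\mathbb{R}^k$, and for $z\in D([0,\infty):\mathbb{R}^k)$, $\delta,T>0$ put $$\omega_{\mathbb{M}}(z,\delta,T)=\sup\{\mathrm{dist}(z(t_2),[z(t_1),z(t_3)]) : 0\le t_1<t_2<t_3\le T,\ t_3-t_1<\delta\}.$$ A sequence $z_n$ converges to $z$ in $\mathcal{M}_1$ if $z_n(t)\to z(t)$ for all $t$ in a dense subset of $[0,\infty)$ containing $0$, and $\lim_{\delta\to0}\limsup_{n\to\infty}\omega_{\mathbb{M}}(z_n,\delta,T)=0$ for every $T>0$; on $D([0,\infty):\mathbb{R}^k)\times D_\uparrow$, $\mathcal{M}_1$-convergence means convergence of both components. Say that $x$ is monotone on an interval $I$ if $x(s)\in[x(r),x(t)]$ for all $r\le s\le t$ in $I$ (for $k=1$: $x$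 is non-decreasing on $I$ or non-increasing on $I$). Let $\mathrm{Disc}(y)$ be the set of discontinuity times of $y$. Let $k\ge 0$, let $x\in D([0,\infty):\mathbb{R}^k)$ be continuous and let $y\in D_\uparrow$. Then: 1. The composition map is $\mathcal{M}_1$-continuous at $(x,y)$, i.e. $x_n\circ y_n\to x\circ y$ in $\mathcal{M}_1$ for every sequence $(x_n,y_n)$ in $D([0,\infty):\mathbb{R}^k)\times D_\uparrow$ with $(x_n,y_n)\to(x,y)$ in $\mathcal{M}_1$, if and only if $x$ is monotone on $[y(t-),y(t)]$ for every $t\in\mathrm{Disc}(y)$. 2. For every individual sequence $(x_n,y_n)$ in $D([0,\infty):\mathbb{R}^k)\times D_\uparrow$ with $(x_n,y_n)\to(x,y)$ in $\mathcal{M}_1$ and with every $y_n$ continuous, $x_n\circ y_n\to x\circ y$ in $\mathcal{M}_1$ if and only if $x$ is monotone on $[y(t-),y(t)]$ for every $t\in\mathrm{Disc}(y)$. -/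

import Mathlib

open Set Filter Topology
open scoped NNReal ENNReal

/-- A function on `[0, ∞)` is càdlàg: it is right continuous and has left limits everywhere.
(At `t = 0` the condition on left limits is void, since `𝓝[<] (0 : ℝ≥0) = ⊥`.) -/
def IsCadlag {E : Type*} [TopologicalSpace E] (f : ℝ≥0 → E) : Prop :=
  ∀ t : ℝ≥0, ContinuousWithinAt f (Ici t) t ∧ ∃ l : E, Tendsto f (𝓝[<] t) (𝓝 l)

/-- The space `D([0, ∞) : E)` of càdlàg paths with values in `E`. -/
structure CadlagPath (E : Type*) [TopologicalSpace E] where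
  /-- the underlying function -/
  toFun : ℝ≥0 → E
  /-- it is càdlàg -/
  isCadlag : IsCadlag toFun

instance CadlagPath.instCoeFun {E : Type*} [TopologicalSpace E] :
    CoeFun (CadlagPath E) (fun _ => ℝ≥0 → E) :=
  ⟨CadlagPath.toFun⟩

/-- The subspace `D_↑` of `D([0, ∞) : ℝ)`: the non-decreasing, non-negative paths `y` with
`y t → ∞` as `t → ∞`. -/
def CadlagUp : Set (CadlagPath ℝ) :=
  {y | Monotone y.toFun ∧ (∀ t, 0 ≤ y t) ∧ Tendsto y.toFun atTop atTop}

theorem isCadlag_comp {E : Type*} [TopologicalSpace E] {f : ℝ≥0 → E} {g : ℝ≥0 → ℝ≥0}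
    (hf : IsCadlag f) (hg : Monotone g) (hg' : IsCadlag g) : IsCadlag (fun t => f (g t)) := by
  intro t
  refine ⟨?_, ?_⟩
  · exact (hf (g t)).1.comp (hg' t).1 (fun s hs => hg hs)
  · obtain ⟨l, hl⟩ := (hg' t).2
    by_cases hbot : 𝓝[<] t = ⊥
    · exact ⟨f 0, by rw [hbot]; exact tendsto_bot⟩
    have : (𝓝[<] t).NeBot := ⟨hbot⟩
    have hle : ∀ s, s < t → g s ≤ l := by
      intro s hs
      refine ge_of_tendsto hl ?_
      filter_upwards [Ioo_mem_nhdsLT hs] with r hr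
      exact hg hr.1.le
    by_cases hex : ∃ s, s < t ∧ g s = l
    · obtain ⟨s, hs, hsl⟩ := hex
      refine ⟨f l, tendsto_const_nhds.congr' ?_⟩
      filter_upwards [Ioo_mem_nhdsLT hs] with r hr
      rw [le_antisymm (hle r hr.2) (hsl ▸ hg hr.1.le)]
    · push Not at hex
      obtain ⟨m, hm⟩ := (hf l).2
      refine ⟨m, hm.comp (tendsto_nhdsWithin_iff.2 ⟨hl, ?_⟩)⟩
      filter_upwards [self_mem_nhdsWithin] with r hr
      exact lt_of_le_of_ne (hle r hr) (hex r hr)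

theorem isCadlag_toNNReal {g : ℝ≥0 → ℝ} (hg : IsCadlag g) :
    IsCadlag (fun t => (g t).toNNReal) := by
  intro t
  obtain ⟨l, hl⟩ := (hg t).2
  exact ⟨(continuous_real_toNNReal.tendsto _).comp (hg t).1, l.toNNReal,
    (continuous_real_toNNReal.tendsto _).comp hl⟩

/-- The composition `x ∘ y ∈ D([0, ∞) : E)` of `x ∈ D([0, ∞) : E)` and `y ∈ D_↑`. Since `y ≥ 0`,
`Real.toNNReal` is here only the passage from non-negative reals to the index set `[0, ∞)`. -/
def CadlagPath.comp {E : Type*} [TopologicalSpace E] (x : CadlagPath E) (y : CadlagUp) :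
    CadlagPath E where
  toFun t := x (y.1 t).toNNReal
  isCadlag := isCadlag_comp x.isCadlag (fun _ _ h => Real.toNNReal_le_toNNReal (y.2.1 h))
    (isCadlag_toNNReal y.1.isCadlag)

/-- The oscillation modulus of the M1-topology:
`ω_M(x, δ, T) = sup {dist (x t₂, [x t₁, x t₃]) : 0 ≤ t₁ < t₂ < t₃ ≤ T, t₃ - t₁ < δ}`,
where `[a, b]` is the line segment between `a` and `b` in `E`. -/
noncomputable def modulusM1 {E : Type*} [NormedAddCommGroup E] [NormedSpace ℝ E]
    (x : CadlagPath E) (δ T : ℝ≥0) : ℝ≥0∞ :=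
  ⨆ (t₁ : ℝ≥0) (t₂ : ℝ≥0) (t₃ : ℝ≥0)
    (_ : t₁ < t₂ ∧ t₂ < t₃ ∧ t₃ ≤ T ∧ t₃ - t₁ < δ),
    Metric.infEDist (x t₂) (segment ℝ (x t₁) (x t₃))

/-- Convergence `x_n → x` in the (strong) M1-topology on `D([0, ∞) : E)`: pointwise convergence on
a dense set of times that contains `0`, together with
`lim_{δ → 0} limsup_n ω_M(x_n, δ, T) = 0` for every `T > 0`. (The boundedness of `x_n t` in `n`
for `t` in a dense set of times containing `0` follows from the first condition when `E` has finite
dimension.) -/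
def TendstoM1 {E : Type*} [NormedAddCommGroup E] [NormedSpace ℝ E]
    (xs : ℕ → CadlagPath E) (x : CadlagPath E) : Prop :=
  (∃ S : Set ℝ≥0, Dense S ∧ 0 ∈ S ∧ ∀ t ∈ S, Tendsto (fun n => xs n t) atTop (𝓝 (x t))) ∧
  ∀ T : ℝ≥0, 0 < T →
    Tendsto (fun δ : ℝ≥0 => limsup (fun n => modulusM1 (xs n) δ T) atTop) (𝓝[>] 0) (𝓝 0)

/-- `Disc(y)`, the set of discontinuity times of a path. -/
def CadlagPath.disc {E : Type*} [TopologicalSpace E] (y : CadlagPath E) : Set ℝ≥0 :=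
  {t | ¬ ContinuousAt y.toFun t}

/-- The interval `[y(t-), y(t)]`, as a set of times. -/
noncomputable def jumpInterval (y : CadlagPath ℝ) (t : ℝ≥0) : Set ℝ≥0 :=
  {s | Function.leftLim y.toFun t ≤ (s : ℝ) ∧ (s : ℝ) ≤ y t}

/-- A function with values in a real vector space is monotone on a set of times `I`: the value at
an intermediate time lies on the line segment between the values at the two outer times. For
real-valued functions this says that the function is non-decreasing on `I` or non-increasing
on `I`. -/
def SegmentMonotoneOn {E : Type*} [AddCommGroup E] [Module ℝ E] (f : ℝ≥0 → E)
    (I : Set ℝ≥0) : Prop :=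
  ∀ r ∈ I, ∀ s ∈ I, ∀ t ∈ I, r ≤ s → s ≤ t → f s ∈ segment ℝ (f r) (f t)

/-! Since `x` is continuous, `x_n → x` locally uniformly, so `x_n ∘ y_n` may be replaced by `x ∘
y_n`, and only the values of `y_n` near a fixed time `t` matter. Sufficiency: there `y_n` stays
close to `[y(t-), y(t)]`. Clamping its values to that interval changes `x` little and keeps them
ordered, so monotonicity of `x` puts the middle value on the segment; compactness of `[0, T]` makes
this local bound uniform (`tendsto_limsup_modulusM1`, `tendstoM1_comp`). Necessity: a continuous
`y_n` crosses a jump of `y` in a short time and attains all values strictly inside it, so a small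
modulus of `x_n ∘ y_n` forces `x` to be monotone there (`segmentMonotoneOn_of_tendstoM1_comp`). For
part 1 such `y_n` exist: left averages of `y`. -/

/-! ### Distance to segments and the M1 modulus -/

section Modulus

variable {E : Type*} [NormedAddCommGroup E] [NormedSpace ℝ E]

/-- Points with equal weights on the two segments are within `d`, which bounds the Hausdorff
distance; moving `p` to `q` costs another `d`. -/
theorem infEDist_segment_le_add {p q a b a' b' : E} {d : ℝ} (hp : dist p q ≤ d)
    (ha : dist a a' ≤ d) (hb : dist b b' ≤ d) :
    Metric.infEDist p (segment ℝ a b) ≤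
      Metric.infEDist q (segment ℝ a' b') + ENNReal.ofReal (2 * d) := by
  have hd : 0 ≤ d := dist_nonneg.trans hp
  have key : ∀ {a b a' b' : E}, dist a a' ≤ d → dist b b' ≤ d → ∀ z ∈ segment ℝ a b,
      ∃ w ∈ segment ℝ a' b', edist z w ≤ ENNReal.ofReal d := by
    rintro a b a' b' ha hb _ ⟨r, s, hr, hs, hrs, rfl⟩
    refine ⟨r • a' + s • b', ⟨r, s, hr, hs, hrs, rfl⟩, ?_⟩
    rw [edist_dist]
    apply ENNReal.ofReal_le_ofReal
    calc dist (r • a + s • b) (r • a' + s • b')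
        ≤ dist (r • a) (r • a') + dist (s • b) (s • b') := dist_add_add_le _ _ _ _
      _ = r * dist a a' + s * dist b b' := by
        simp [dist_smul₀, abs_of_nonneg hr, abs_of_nonneg hs]
      _ ≤ r * d + s * d := by gcongr
      _ = d := by rw [← add_mul, hrs, one_mul]
  have hH : Metric.hausdorffEDist (segment ℝ a' b') (segment ℝ a b) ≤ ENNReal.ofReal d :=
    Metric.hausdorffEDist_le_of_mem_edist
      (key (by rwa [dist_comm]) (by rwa [dist_comm])) (key ha hb)
  calc Metric.infEDist p (segment ℝ a b)
      ≤ Metric.infEDist q (segment ℝ a b) + edist p q := Metric.infEDist_le_infEDist_add_edist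
    _ ≤ (Metric.infEDist q (segment ℝ a' b') + ENNReal.ofReal d) + ENNReal.ofReal d := by
      gcongr
      · exact Metric.infEDist_le_infEDist_add_hausdorffEDist.trans (by gcongr)
      · rw [edist_dist]; exact ENNReal.ofReal_le_ofReal hp
    _ = _ := by rw [add_assoc, ← ENNReal.ofReal_add hd hd, two_mul]

theorem infEDist_segment_le_of_mem {p q a b a' b' : E} {d : ℝ} (hp : dist p q ≤ d)
    (ha : dist a a' ≤ d) (hb : dist b b' ≤ d) (hq : q ∈ segment ℝ a' b') :
    Metric.infEDist p (segment ℝ a b) ≤ ENNReal.ofReal (2 * d) := by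
  simpa [Metric.infEDist_zero_of_mem hq] using infEDist_segment_le_add hp ha hb

theorem isClosed_segment (a b : E) : IsClosed (segment ℝ a b) := by
  rw [segment_eq_image_lineMap]
  exact (isCompact_Icc.image AffineMap.lineMap_continuous).isClosed

/-- Balls are convex, so the whole segment stays within `d` of `c`. -/
theorem dist_le_of_infEDist_segment_le {p a b c : E} {d e : ℝ} (he : 0 ≤ e)
    (h : Metric.infEDist p (segment ℝ a b) ≤ ENNReal.ofReal e)
    (ha : dist a c ≤ d) (hb : dist b c ≤ d) : dist p c ≤ e + d := by
  refine le_of_forall_pos_le_add fun η hη => ?_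
  have hlt : Metric.infEDist p (segment ℝ a b) < ENNReal.ofReal (e + η) :=
    h.trans_lt ((ENNReal.ofReal_lt_ofReal_iff (by linarith)).2 (by linarith))
  obtain ⟨z, hz, hpz⟩ := Metric.infEDist_lt_iff.1 hlt
  rw [edist_dist, ENNReal.ofReal_lt_ofReal_iff (by linarith)] at hpz
  have hzc : z ∈ Metric.closedBall c d :=
    (convex_closedBall c d).segment_subset (by simpa using ha) (by simpa using hb) hz
  have := dist_triangle p z c
  rw [Metric.mem_closedBall] at hzc
  linarith

/-- The modulus condition of M1-convergence may be checked locally in time. -/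
theorem tendsto_limsup_modulusM1 {xs : ℕ → CadlagPath E}
    (h : ∀ t : ℝ≥0, ∀ ε : ℝ, 0 < ε → ∃ U ∈ 𝓝 t, ∀ᶠ n in atTop,
      ∀ t₁ ∈ U, ∀ t₂ ∈ U, ∀ t₃ ∈ U, t₁ < t₂ → t₂ < t₃ →
        Metric.infEDist (xs n t₂) (segment ℝ (xs n t₁) (xs n t₃)) ≤ ENNReal.ofReal ε)
    (T : ℝ≥0) :
    Tendsto (fun δ : ℝ≥0 => limsup (fun n => modulusM1 (xs n) δ T) atTop) (𝓝[>] 0) (𝓝 0) := by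
  refine ENNReal.tendsto_nhds_zero.2 fun e he => ?_
  obtain ⟨ε, hε, hεe⟩ : ∃ ε : ℝ, 0 < ε ∧ ENNReal.ofReal ε ≤ e := by
    obtain ⟨r, hr, hre⟩ := ENNReal.lt_iff_exists_nnreal_btwn.1 he
    exact ⟨r, by simpa using hr, by simpa using hre.le⟩
  -- Compactness of `[0, T]` yields one range of `(δ, n)` that serves every `t₁` at once.
  have hmem : {p : (ℝ≥0 × ℕ) × ℝ≥0 | ∀ t₂ t₃, p.2 < t₂ → t₂ < t₃ → t₃ - p.2 < p.1.1 →
      Metric.infEDist (xs p.1.2 t₂) (segment ℝ (xs p.1.2 p.2) (xs p.1.2 t₃)) ≤ ENNReal.ofReal ε} ∈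
      (𝓝[>] (0 : ℝ≥0) ×ˢ atTop) ×ˢ 𝓝ˢ (Icc 0 T) := by
    refine isCompact_Icc.mem_prod_nhdsSet_of_forall fun t _ => ?_
    obtain ⟨U, hU, hn⟩ := h t ε hε
    obtain ⟨η, hη, hball⟩ := Metric.mem_nhds_iff.1 hU
    have hδ : ∀ᶠ δ : ℝ≥0 in 𝓝[>] 0, (δ : ℝ) < η / 2 := by
      have : Tendsto (fun δ : ℝ≥0 => (δ : ℝ)) (𝓝[>] 0) (𝓝 0) := by
        simpa using (NNReal.continuous_coe.tendsto 0).mono_left nhdsWithin_le_nhds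
      exact this.eventually_lt_const (by linarith)
    filter_upwards [(hδ.prod_mk hn).prod_mk (Metric.ball_mem_nhds t (half_pos hη))]
    rintro ⟨⟨δ, n⟩, t₁⟩ ⟨⟨hδ, hn⟩, ht₁⟩ t₂ t₃ h12 h23 h13
    have ht1 : |(t₁ : ℝ) - t| < η / 2 := by simpa [NNReal.dist_eq] using ht₁
    rw [abs_lt] at ht1
    have h12' : (t₁ : ℝ) < t₂ := by exact_mod_cast h12
    have h23' : (t₂ : ℝ) < t₃ := by exact_mod_cast h23
    have h13' : (t₃ : ℝ) - t₁ < δ := by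
      rw [← NNReal.coe_sub (h12.trans h23).le]; exact_mod_cast h13
    dsimp only at hδ hn
    refine hn t₁ (hball ?_) t₂ (hball ?_) t₃ (hball ?_) h12 h23 <;>
      rw [Metric.mem_ball, NNReal.dist_eq, abs_lt] <;> constructor <;> linarith
  have h2 : ∀ᶠ p : ℝ≥0 × ℕ in 𝓝[>] (0 : ℝ≥0) ×ˢ atTop, modulusM1 (xs p.2) p.1 T ≤ e := by
    filter_upwards [Filter.Eventually.curry hmem] with p hp
    refine iSup_le fun t₁ => iSup_le fun t₂ => iSup_le fun t₃ => iSup_le ?_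
    rintro ⟨h12, h23, h3, h13⟩
    exact (hp.self_of_nhdsSet t₁ ⟨zero_le, (h12.trans h23).le.trans h3⟩ t₂ t₃ h12 h23
      h13).trans hεe
  filter_upwards [h2.curry] with δ hδ
  exact limsup_le_of_le (by isBoundedDefault) hδ

theorem TendstoM1.exists_infEDist_segment_le {xs : ℕ → CadlagPath E} {x : CadlagPath E}
    (h : TendstoM1 xs x) {T : ℝ≥0} (hT : 0 < T) {ε : ℝ} (hε : 0 < ε) :
    ∃ δ : ℝ≥0, 0 < δ ∧ ∀ᶠ n in atTop, ∀ t₁ t₂ t₃ : ℝ≥0, t₁ ≤ t₂ → t₂ ≤ t₃ → t₃ ≤ T →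
      t₃ - t₁ < δ →
        Metric.infEDist (xs n t₂) (segment ℝ (xs n t₁) (xs n t₃)) ≤ ENNReal.ofReal ε := by
  obtain ⟨δ, hδ, hpos⟩ := (((h.2 T hT).eventually_lt_const (ENNReal.ofReal_pos.2 hε)).and
    self_mem_nhdsWithin).exists
  refine ⟨δ, hpos, (eventually_lt_of_limsup_lt hδ).mono fun n hn t₁ t₂ t₃ h12 h23 h3 h13 => ?_⟩
  rcases h12.eq_or_lt with rfl | h12
  · simp [Metric.infEDist_zero_of_mem (left_mem_segment ℝ _ _)]
  rcases h23.eq_or_lt with rfl | h23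
  · simp [Metric.infEDist_zero_of_mem (right_mem_segment ℝ _ _)]
  refine le_trans ?_ hn.le
  exact le_iSup_of_le t₁ <| le_iSup_of_le t₂ <| le_iSup_of_le t₃ <|
    le_iSup_of_le ⟨h12, h23, h3, h13⟩ le_rfl

/-- At `t = 0` the left endpoint must be `0` itself, hence the requirement `0 ∈ S`. -/
theorem Dense.exists_Icc_mem_nhds {S : Set ℝ≥0} (hS : Dense S) (h0 : 0 ∈ S) {t : ℝ≥0}
    {U : Set ℝ≥0} (hU : U ∈ 𝓝 t) :
    ∃ a ∈ S, ∃ b ∈ S, Icc a b ∈ 𝓝 t ∧ Icc a b ⊆ U ∧ a ≤ t ∧ t < b ∧ (0 < t → a < t) := by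
  obtain ⟨v, htv, hv⟩ := exists_Ico_subset_of_mem_nhds hU (exists_gt t)
  obtain ⟨b, hbS, htb, hbv⟩ := hS.exists_between htv
  rcases eq_zero_or_pos t with rfl | ht
  · refine ⟨0, h0, b, hbS, ?_, fun s hs => hv ⟨hs.1, hs.2.trans_lt hbv⟩, le_rfl, htb,
      fun h => h⟩
    filter_upwards [Iio_mem_nhds htb] with s hs using ⟨zero_le, hs.le⟩
  · obtain ⟨w, hwt, hw⟩ := exists_Ioc_subset_of_mem_nhds hU ⟨0, ht⟩
    obtain ⟨a, haS, hwa, hat⟩ := hS.exists_between hwt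
    refine ⟨a, haS, b, hbS, Icc_mem_nhds hat htb, fun s hs => ?_, hat.le, htb, fun _ => hat⟩
    rcases le_total s t with h | h
    · exact hw ⟨hwa.trans_le hs.1, h⟩
    · exact hv ⟨h, hs.2.trans_lt hbv⟩

end Modulus

/-! ### Locally uniform convergence and sufficiency -/

theorem TendstoLocallyUniformly.exists_eventually_dist_lt {E : Type*}
    [PseudoMetricSpace E] {fs : ℕ → ℝ≥0 → E} {f : ℝ≥0 → E}
    (h : TendstoLocallyUniformly fs f atTop) (B : ℝ≥0) {ε : ℝ} (hε : 0 < ε) :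
    ∀ᶠ n in atTop, ∀ s ≤ B, dist (fs n s) (f s) < ε := by
  have := (tendstoLocallyUniformlyOn_iff_tendstoUniformlyOn_of_compact
    (isCompact_Icc (a := 0) (b := B))).1 h.tendstoLocallyUniformlyOn
  filter_upwards [Metric.tendstoUniformlyOn_iff.1 this ε hε] with n hn s hs
  rw [dist_comm]
  exact hn s ⟨zero_le, hs⟩

theorem Continuous.exists_dist_clamp_lt {E : Type*} [PseudoMetricSpace E] {x : ℝ≥0 → E} (hx : Continuous x)
    {l u : ℝ≥0} (hlu : l ≤ u) {ε : ℝ} (hε : 0 < ε) :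
    ∃ η : ℝ, 0 < η ∧ ∀ s : ℝ≥0, (l : ℝ) - η < s → (s : ℝ) < u + η →
      dist (x s) (x (max l (min s u))) < ε := by
  obtain ⟨η₁, h1, hl⟩ := Metric.continuous_iff.1 hx l ε hε
  obtain ⟨η₂, h2, hu⟩ := Metric.continuous_iff.1 hx u ε hε
  refine ⟨min η₁ η₂, lt_min h1 h2, fun s hs1 hs2 => ?_⟩
  have := min_le_left η₁ η₂
  have := min_le_right η₁ η₂
  rcases lt_or_ge s l with hsl | hsl
  · rw [min_eq_left (hsl.le.trans hlu), max_eq_left hsl.le]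
    have : (s : ℝ) < l := by exact_mod_cast hsl
    exact hl s (by rw [NNReal.dist_eq, abs_lt]; constructor <;> linarith)
  rcases lt_or_ge u s with hsu | hsu
  · rw [min_eq_right hsu.le, max_eq_right hlu]
    have : (u : ℝ) < s := by exact_mod_cast hsu
    exact hu s (by rw [NNReal.dist_eq, abs_lt]; constructor <;> linarith)
  · rw [min_eq_left hsu, max_eq_right hsl, dist_self]; exact hε

section Convergence

variable {E : Type*} [NormedAddCommGroup E] [NormedSpace ℝ E]

/-- M1-convergence to a continuous path is locally uniform. -/
theorem TendstoM1.tendstoLocallyUniformly {xs : ℕ → CadlagPath E} {x : CadlagPath E}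
    (h : TendstoM1 xs x) (hx : Continuous x.toFun) :
    TendstoLocallyUniformly (fun n => (xs n).toFun) x.toFun atTop := by
  rw [Metric.tendstoLocallyUniformly_iff]
  intro ε hε t
  obtain ⟨S, hS, h0, hpt⟩ := h.1
  have hT : 0 < t + 1 := by positivity
  obtain ⟨δ, hδ, hn⟩ := h.exists_infEDist_segment_le hT (ε := ε / 4) (by linarith)
  have hU : {s | dist (x s) (x t) < ε / 4} ∩ {s | dist s t < δ / 2} ∩ Iio (t + 1) ∈ 𝓝 t := by
    refine inter_mem (inter_mem ?_ ?_) (Iio_mem_nhds (by simp))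
    · exact hx.continuousAt (Metric.ball_mem_nhds _ (by linarith))
    · exact Metric.ball_mem_nhds t (by positivity)
  obtain ⟨a, haS, b, hbS, hab, hsub, hat, htb, -⟩ := hS.exists_Icc_mem_nhds h0 hU
  refine ⟨_, hab, ?_⟩
  have haU := hsub (left_mem_Icc.2 (hat.trans htb.le))
  have hbU := hsub (right_mem_Icc.2 (hat.trans htb.le))
  have hlen : b - a < δ := by
    have h1 := haU.1.2
    have h2 := hbU.1.2
    simp only [mem_ofPred_eq, NNReal.dist_eq, abs_lt] at h1 h2
    rw [← NNReal.coe_lt_coe, NNReal.coe_sub (hat.trans htb.le)]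
    linarith
  filter_upwards [hn, Metric.tendsto_nhds.1 (hpt a haS) (ε / 4) (by linarith),
    Metric.tendsto_nhds.1 (hpt b hbS) (ε / 4) (by linarith)] with n hn hna hnb s hs
  have hxa : dist (x a) (x t) < ε / 4 := haU.1.1
  have hxb : dist (x b) (x t) < ε / 4 := hbU.1.1
  have hxs : dist (x s) (x t) < ε / 4 := (hsub hs).1.1
  -- Both endpoint values are within `ε / 4 + ε / 4` of `x t`, so `xs n s` is within `3ε / 4`; the
  -- last `ε / 4` is for `x s`.
  have := dist_le_of_infEDist_segment_le (c := x t) (d := ε / 2) (by linarith)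
    (hn a s b hs.1 hs.2 hbU.2.le hlen)
    (by linarith [dist_triangle (xs n a) (x a) (x t)])
    (by linarith [dist_triangle (xs n b) (x b) (x t)])
  rw [dist_comm] at this ⊢
  have h3 := dist_triangle_left (xs n s) (x s) (x t)
  rw [dist_comm (x t) (xs n s), dist_comm (x t) (x s)] at *
  linarith

theorem tendstoM1_const {x : CadlagPath E} (hx : Continuous x.toFun) :
    TendstoM1 (fun _ => x) x := by
  refine ⟨⟨univ, dense_univ, mem_univ _, fun t _ => tendsto_const_nhds⟩,
    fun T _ => tendsto_limsup_modulusM1 (fun t ε hε => ?_) T⟩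
  refine ⟨{s | dist (x s) (x t) < ε / 2}, hx.continuousAt (Metric.ball_mem_nhds _ (half_pos hε)),
    Eventually.of_forall fun _ t₁ h1 t₂ h2 t₃ h3 _ _ => ?_⟩
  refine (Metric.infEDist_le_edist_of_mem (left_mem_segment ℝ _ _)).trans ?_
  rw [edist_dist]
  have h1 : dist (x t₁) (x t) < ε / 2 := h1
  have h2 : dist (x t₂) (x t) < ε / 2 := h2
  exact ENNReal.ofReal_le_ofReal (by linarith [dist_triangle_right (x t₂) (x t₁) (x t)])

/-- Monotone real paths have zero modulus, so only pointwise convergence remains. -/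
theorem tendstoM1_of_monotone {ys : ℕ → CadlagPath ℝ} {y : CadlagPath ℝ}
    (hys : ∀ n, Monotone (ys n).toFun) {S : Set ℝ≥0} (hS : Dense S) (h0 : 0 ∈ S)
    (h : ∀ t ∈ S, Tendsto (fun n => ys n t) atTop (𝓝 (y t))) : TendstoM1 ys y := by
  refine ⟨⟨S, hS, h0, h⟩, fun T _ => tendsto_limsup_modulusM1 (fun t ε _ => ?_) T⟩
  refine ⟨univ, univ_mem, Eventually.of_forall fun n t₁ _ t₂ _ t₃ _ h12 h23 => ?_⟩
  rw [Metric.infEDist_zero_of_mem]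
  · exact zero_le
  · rw [segment_eq_Icc (hys n (h12.trans h23).le)]
    exact ⟨hys n h12.le, hys n h23.le⟩

theorem leftLim_zero (f : ℝ≥0 → ℝ) : Function.leftLim f 0 = f 0 :=
  leftLim_eq_of_isBot isBot_bot

theorem leftLim_nonneg (y : CadlagUp) (t : ℝ≥0) : 0 ≤ Function.leftLim y.1.toFun t := by
  rcases eq_zero_or_pos t with rfl | ht
  · rw [leftLim_zero]; exact y.2.2.1 0
  · exact (y.2.2.1 0).trans (y.2.1.le_leftLim ht)

/-- Near a time `t`, the paths `ys n` eventually take values close to `[y(t-), y(t)]`. -/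
theorem exists_nhds_mem_Ioo {ys : ℕ → CadlagUp} {y : CadlagUp}
    (h : TendstoM1 (fun n => (ys n).1) y.1) (t : ℝ≥0) {η : ℝ} (hη : 0 < η) :
    ∃ U ∈ 𝓝 t, ∀ᶠ n in atTop, ∀ s ∈ U,
      (ys n).1 s ∈ Ioo (Function.leftLim y.1.toFun t - η) (y.1 t + η) := by
  obtain ⟨S, hS, h0, hpt⟩ := h.1
  have hU : {s | s < t → Function.leftLim y.1.toFun t - η < y.1 s} ∩
      {s | t ≤ s → y.1 s < y.1 t + η} ∈ 𝓝 t := by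
    refine inter_mem ?_ ?_
    · have := (y.2.1.tendsto_leftLim t).eventually_const_lt (sub_lt_self _ hη)
      exact eventually_nhdsWithin_iff.1 this
    · have := Tendsto.eventually_lt_const (lt_add_of_pos_right _ hη)
        (y.1.isCadlag t).1.tendsto
      exact eventually_nhdsWithin_iff.1 this
  obtain ⟨a, haS, b, hbS, hab, hsub, hat, htb, hat'⟩ := hS.exists_Icc_mem_nhds h0 hU
  refine ⟨_, hab, ?_⟩
  have ha : Function.leftLim y.1.toFun t - η < y.1 a := by
    rcases eq_zero_or_pos t with rfl | ht
    · rw [leftLim_zero, nonpos_iff_eq_zero.1 hat]; linarith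
    · exact (hsub (left_mem_Icc.2 (hat.trans htb.le))).1 (hat' ht)
  have hb : y.1 b < y.1 t + η := (hsub (right_mem_Icc.2 (hat.trans htb.le))).2 htb.le
  -- Monotonicity of `ys n` carries the bounds at the endpoints to all of `[a, b]`.
  filter_upwards [(hpt a haS).eventually_const_lt ha, (hpt b hbS).eventually_lt_const hb]
    with n hna hnb s hs
  exact ⟨hna.trans_le ((ys n).2.1 hs.1), ((ys n).2.1 hs.2).trans_lt hnb⟩

theorem tendstoM1_comp {xs : ℕ → CadlagPath E} {x : CadlagPath E} {ys : ℕ → CadlagUp}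
    {y : CadlagUp} (hx : Continuous x.toFun) (hxs : TendstoM1 xs x)
    (hys : TendstoM1 (fun n => (ys n).1) y.1)
    (hmono : ∀ t ∈ y.1.disc, SegmentMonotoneOn x.toFun (jumpInterval y.1 t)) :
    TendstoM1 (fun n => (xs n).comp (ys n)) (x.comp y) := by
  have hloc := hxs.tendstoLocallyUniformly hx
  refine ⟨?_, fun T _ => tendsto_limsup_modulusM1 (fun t ε hε => ?_) T⟩
  · obtain ⟨S, hS, h0, hpt⟩ := hys.1
    exact ⟨S, hS, h0, fun t ht => hloc.tendsto_comp hx.continuousAt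
      ((continuous_real_toNNReal.tendsto _).comp (hpt t ht))⟩
  have hl0 := leftLim_nonneg y t
  have hlu : Function.leftLim y.1.toFun t ≤ y.1 t := y.2.1.leftLim_le le_rfl
  lift Function.leftLim y.1.toFun t to ℝ≥0 using hl0 with l hl
  obtain ⟨u, hu⟩ : ∃ u : ℝ≥0, (u : ℝ) = y.1 t := ⟨⟨_, y.2.2.1 t⟩, rfl⟩
  rw [← hu, NNReal.coe_le_coe] at hlu
  obtain ⟨η, hη, hclamp⟩ := hx.exists_dist_clamp_lt hlu (ε := ε / 4) (by linarith)
  obtain ⟨U, hU, hn⟩ := exists_nhds_mem_Ioo hys t hη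
  refine ⟨U, hU, ?_⟩
  have hseg : ∀ r ∈ Icc l u, ∀ s ∈ Icc l u, ∀ v ∈ Icc l u, r ≤ s → s ≤ v →
      x s ∈ segment ℝ (x r) (x v) := by
    intro r hr s hs v hv hrs hsv
    by_cases hd : t ∈ y.1.disc
    · have hmem : ∀ w ∈ Icc l u, w ∈ jumpInterval y.1 t := fun w hw =>
        ⟨hl ▸ NNReal.coe_le_coe.2 hw.1, hu ▸ NNReal.coe_le_coe.2 hw.2⟩
      exact hmono t hd r (hmem r hr) s (hmem s hs) v (hmem v hv) hrs hsv
    -- At a continuity point of `y` the interval is a single point.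
    · have hc : ContinuousAt y.1.toFun t := not_not.1 hd
      have hlu' : l = u := by
        rw [← NNReal.coe_inj, hl, hu]
        exact hc.continuousWithinAt.leftLim_eq
      subst hlu'
      rw [Icc_self, mem_singleton_iff] at hr hs hv
      subst hr hs hv
      simp
  obtain ⟨B, hB⟩ : ∃ B : ℝ≥0, (u : ℝ) + η ≤ B := ⟨(u + η).toNNReal, Real.le_coe_toNNReal _⟩
  filter_upwards [hn, hloc.exists_eventually_dist_lt B (ε := ε / 4) (by linarith)]
    with n hn hxn t₁ h1 t₂ h2 t₃ h3 h12 h23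
  -- One `ε / 4` replaces `xs n` by `x`, the other pays for the clamping to `[l, u]`.
  have hc : ∀ s ∈ U, dist (((xs n).comp (ys n)) s)
      (x (max l (min ((ys n).1 s).toNNReal u))) ≤ ε / 2 := by
    intro s hs
    have hmem := hn s hs
    rw [← hl, ← hu, ← Real.coe_toNNReal _ ((ys n).2.2.1 s)] at hmem
    have h4 := hclamp _ hmem.1 hmem.2
    have h5 := hxn ((ys n).1 s).toNNReal (by
      rw [← NNReal.coe_le_coe]; exact hmem.2.le.trans hB)
    exact (dist_triangle _ (x ((ys n).1 s).toNNReal) _).trans (by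
      have : dist (((xs n).comp (ys n)) s) (x ((ys n).1 s).toNNReal) < ε / 4 := h5
      linarith)
  have hm : Monotone fun s => max l (min ((ys n).1 s).toNNReal u) := fun a b hab =>
    max_le_max le_rfl (min_le_min (Real.toNNReal_le_toNNReal ((ys n).2.1 hab)) le_rfl)
  have hI : ∀ s : ℝ≥0, max l (min s u) ∈ Icc l u := fun s =>
    ⟨le_max_left _ _, max_le hlu (min_le_right _ _)⟩
  have := infEDist_segment_le_of_mem (hc t₂ h2) (hc t₁ h1) (hc t₃ h3)
    (hseg _ (hI _) _ (hI _) _ (hI _) (hm h12.le) (hm h23.le))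
  rwa [mul_div_cancel₀ _ two_ne_zero] at this

end Convergence

/-! ### Necessity, from a single sequence with continuous `y_n` -/

section Necessity

variable {E : Type*} [NormedAddCommGroup E] [NormedSpace ℝ E]

theorem segmentMonotoneOn_of_tendstoM1_comp {xs : ℕ → CadlagPath E} {x : CadlagPath E}
    {ys : ℕ → CadlagUp} {y : CadlagUp} (hx : Continuous x.toFun) (hxs : TendstoM1 xs x)
    (hys : TendstoM1 (fun n => (ys n).1) y.1) (hcont : ∀ n, Continuous (ys n).1.toFun)
    (h : TendstoM1 (fun n => (xs n).comp (ys n)) (x.comp y)) (t : ℝ≥0) :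
    SegmentMonotoneOn x.toFun (jumpInterval y.1 t) := by
  intro r hr s _ u hu hrs hsu
  rcases hrs.eq_or_lt with rfl | hrs
  · exact left_mem_segment ℝ _ _
  rcases hsu.eq_or_lt with rfl | hsu
  · exact right_mem_segment ℝ _ _
  have ht : 0 < t := by
    rw [pos_iff_ne_zero]
    rintro rfl
    have h1 := hr.1
    have h2 := hu.2
    rw [leftLim_zero] at h1
    have : (r : ℝ) < u := by exact_mod_cast hrs.trans hsu
    linarith
  rw [Metric.mem_iff_infEDist_zero_of_closed (isClosed_segment _ _), ← nonpos_iff_eq_zero]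
  have htends : Tendsto ENNReal.ofReal (𝓝[>] 0) (𝓝 0) := by
    simpa using (ENNReal.continuous_ofReal.tendsto 0).mono_left nhdsWithin_le_nhds
  refine ge_of_tendsto htends ?_
  filter_upwards [self_mem_nhdsWithin] with ε hε
  rw [mem_Ioi] at hε
  have hε8 : 0 < ε / 8 := by linarith
  -- `r` and `u` may be the ends of the jump, which `ys n` need not reach near `t`. Moving them
  -- inwards gives strict inequalities at `a` and `b` that pass from `y` to `ys n`.
  obtain ⟨r', hr', hrr', hr's⟩ :=
    ((hx.continuousAt.continuousWithinAt.eventually (Metric.ball_mem_nhds (x r) hε8)).and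
      (Ioo_mem_nhdsGT hrs)).exists
  have : (𝓝[<] u).NeBot := nhdsLT_neBot_of_exists_lt ⟨s, hsu⟩
  obtain ⟨u', hu', hsu', hu'u⟩ :=
    ((hx.continuousAt.continuousWithinAt.eventually (Metric.ball_mem_nhds (x u) hε8)).and
      (Ioo_mem_nhdsLT hsu)).exists
  obtain ⟨S, hS, h0, hpt⟩ := hys.1
  have hT : 0 < t + 1 := by positivity
  obtain ⟨δ, hδ, hn⟩ := h.exists_infEDist_segment_le hT (ε := ε / 2) (by linarith)
  have hU : {s | dist s t < δ / 2} ∩ Iio (t + 1) ∈ 𝓝 t :=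
    inter_mem (Metric.ball_mem_nhds t (by positivity)) (Iio_mem_nhds (by simp))
  obtain ⟨a, haS, b, hbS, -, hsub, hat, htb, hat'⟩ := hS.exists_Icc_mem_nhds h0 hU
  have hab := hat.trans htb.le
  have haU := hsub (left_mem_Icc.2 hab)
  have hbU := hsub (right_mem_Icc.2 hab)
  have hlen : (b : ℝ) - a < δ := by
    have h1 := haU.1
    have h2 := hbU.1
    simp only [mem_ofPred_eq, NNReal.dist_eq, abs_lt] at h1 h2
    linarith
  have hya : y.1 a < r' :=
    ((y.2.1.le_leftLim (hat' ht)).trans hr.1).trans_lt (by exact_mod_cast hrr')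
  have hyb : (u' : ℝ) < y.1 b :=
    lt_of_lt_of_le (by exact_mod_cast hu'u) (hu.2.trans (y.2.1 htb.le))
  obtain ⟨n, hn, hna, hnb, hxn⟩ := (hn.and (((hpt a haS).eventually_lt_const hya).and
    (((hpt b hbS).eventually_const_lt hyb).and
      ((hxs.tendstoLocallyUniformly hx).exists_eventually_dist_lt u hε8)))).exists
  have hr's' : (r' : ℝ) < s := by exact_mod_cast hr's
  have hsu'' : (s : ℝ) < u' := by exact_mod_cast hsu'
  have hivt := intermediate_value_Icc hab (hcont n).continuousOn
  obtain ⟨t₁, ht₁, h1⟩ := hivt ⟨hna.le, (hr's'.trans (hsu''.trans hnb)).le⟩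
  obtain ⟨t₂, ht₂, h2⟩ := hivt ⟨(hna.trans hr's').le, (hsu''.trans hnb).le⟩
  obtain ⟨t₃, ht₃, h3⟩ := hivt ⟨(hna.trans (hr's'.trans hsu'')).le, hnb.le⟩
  have h12 : t₁ ≤ t₂ := ((ys n).2.1.reflect_lt (by rw [h1, h2]; exact hr's')).le
  have h23 : t₂ ≤ t₃ := ((ys n).2.1.reflect_lt (by rw [h2, h3]; exact hsu'')).le
  have hval : ∀ {τ v : ℝ≥0}, (ys n).1 τ = v → ((xs n).comp (ys n)) τ = xs n v := by
    intro τ v hv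
    change xs n ((ys n).1 τ).toNNReal = _
    rw [hv, Real.toNNReal_coe]
  have hmain := hn t₁ t₂ t₃ h12 h23 (ht₃.2.trans hbU.2.le) (by
    rw [← NNReal.coe_lt_coe, NNReal.coe_sub (h12.trans h23)]
    have e1 : (a : ℝ) ≤ t₁ := by exact_mod_cast ht₁.1
    have e3 : (t₃ : ℝ) ≤ b := by exact_mod_cast ht₃.2
    linarith)
  rw [hval h1, hval h2, hval h3] at hmain
  have hclose : ∀ {v w : ℝ≥0}, v ≤ u → dist (x v) (x w) < ε / 8 →
      dist (x w) (xs n v) ≤ ε / 4 := by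
    intro v w hv hvw
    have := hxn v hv
    have := dist_triangle_left (x w) (xs n v) (x v)
    rw [dist_comm (x v) (xs n v)] at this
    linarith
  -- The total error is `ε / 2` from the modulus and `2 * (ε / 4)` from replacing the three points.
  refine (infEDist_segment_le_add (d := ε / 4) (hclose hsu.le (by rwa [dist_self]))
    (hclose (hr's.le.trans hsu.le) hr') (hclose hu'u.le hu')).trans ?_
  refine (add_le_add_left hmain _).trans ?_
  rw [← ENNReal.ofReal_add (by linarith) (by linarith)]
  exact ENNReal.ofReal_le_ofReal (by linarith)

end Necessity

/-! ### Continuous approximation in `D_↑` -/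

theorem Continuous.isCadlag {E : Type*} [TopologicalSpace E] {f : ℝ≥0 → E} (hf : Continuous f) :
    IsCadlag f := fun _ =>
  ⟨hf.continuousWithinAt, _, hf.continuousWithinAt.tendsto⟩

theorem NNReal.dense_compl_of_countable {C : Set ℝ≥0} (hC : C.Countable) : Dense Cᶜ := by
  refine dense_of_exists_between fun a b hab => ?_
  obtain ⟨c, hc, hac, hcb⟩ := ((hC.image NNReal.toReal).dense_compl ℝ).exists_between
    (NNReal.coe_lt_coe.2 hab)
  lift c to ℝ≥0 using a.coe_nonneg.trans hac.le
  exact ⟨c, fun h => hc ⟨c, h, rfl⟩, NNReal.coe_lt_coe.1 hac, NNReal.coe_lt_coe.1 hcb⟩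

/-- The average of `g` over `[t - h, t]`. -/
noncomputable def leftAverage (g : ℝ → ℝ) (h t : ℝ) : ℝ :=
  h⁻¹ * ∫ s in (t - h)..t, g s

section LeftAverage

variable {g : ℝ → ℝ} {h : ℝ}

theorem continuous_leftAverage (hg : Monotone g) : Continuous (leftAverage g h) := by
  have hF : Continuous fun t => ∫ s in (0 : ℝ)..t, g s :=
    intervalIntegral.continuous_primitive (fun _ _ => hg.intervalIntegrable) 0
  have : leftAverage g h = fun t =>
      h⁻¹ * ((∫ s in (0 : ℝ)..t, g s) - ∫ s in (0 : ℝ)..(t - h), g s) := by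
    funext t
    rw [leftAverage, intervalIntegral.integral_interval_sub_left hg.intervalIntegrable
      hg.intervalIntegrable]
  rw [this]
  exact continuous_const.mul (hF.sub (hF.comp (continuous_id.sub continuous_const)))

theorem monotone_leftAverage (hg : Monotone g) (hh : 0 < h) : Monotone (leftAverage g h) := by
  -- On the fixed interval `[-h, 0]` the integrands can be compared pointwise.
  have key : ∀ t, ∫ s in (t - h)..t, g s = ∫ s in (-h)..0, g (t + s) := by
    intro t
    rw [intervalIntegral.integral_comp_add_left]
    simp [sub_eq_add_neg]
  have hmono : ∀ t, Monotone fun s => g (t + s) := fun t a b hab => hg (by linarith)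
  intro a b hab
  rw [leftAverage, leftAverage, key, key]
  gcongr
  exact intervalIntegral.integral_mono_on (by linarith) (hmono a).intervalIntegrable
    (hmono b).intervalIntegrable fun s _ => hg (by linarith)

/-- With `le_leftAverage` this squeezes the average between `g (t - h)` and `g t`, which gives
convergence at continuity points. -/
theorem leftAverage_le (hg : Monotone g) (hh : 0 < h) (t : ℝ) : leftAverage g h t ≤ g t := by
  have : ∫ s in (t - h)..t, g s ≤ ∫ _ in (t - h)..t, g t :=
    intervalIntegral.integral_mono_on (by linarith) hg.intervalIntegrable
      intervalIntegrable_const fun s hs => hg hs.2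
  rw [intervalIntegral.integral_const, sub_sub_cancel, smul_eq_mul] at this
  rwa [leftAverage, inv_mul_le_iff₀ hh]

theorem le_leftAverage (hg : Monotone g) (hh : 0 < h) (t : ℝ) :
    g (t - h) ≤ leftAverage g h t := by
  have : ∫ _ in (t - h)..t, g (t - h) ≤ ∫ s in (t - h)..t, g s :=
    intervalIntegral.integral_mono_on (by linarith) intervalIntegrable_const
      hg.intervalIntegrable fun s hs => hg hs.1
  rw [intervalIntegral.integral_const, sub_sub_cancel, smul_eq_mul] at this
  rwa [leftAverage, le_inv_mul_iff₀ hh]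

end LeftAverage

/-- Every path in `D_↑` is an M1-limit of continuous paths in `D_↑`. -/
theorem exists_continuous_tendstoM1 (y : CadlagUp) :
    ∃ ys : ℕ → CadlagUp, (∀ n, Continuous (ys n).1.toFun) ∧
      TendstoM1 (fun n => (ys n).1) y.1 := by
  -- The extension by `y 0` to negative times makes the averages meaningful near `0`.
  set g : ℝ → ℝ := fun s => y.1 s.toNNReal with hg_def
  have hg : Monotone g := fun a b hab => y.2.1 (Real.toNNReal_le_toNNReal hab)
  have hgt : ∀ t : ℝ≥0, g t = y.1 t := fun t => by simp [hg_def]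
  set h : ℕ → ℝ := fun n => 1 / ((n : ℝ) + 1) with h_def
  have hh : ∀ n, 0 < h n := fun n => by positivity
  have hlim : Tendsto h atTop (𝓝 0) := tendsto_one_div_add_atTop_nhds_zero_nat
  have hcont : ∀ n, Continuous fun t : ℝ≥0 => leftAverage g (h n) t := fun n =>
    (continuous_leftAverage hg).comp NNReal.continuous_coe
  have hmono : ∀ n, Monotone fun t : ℝ≥0 => leftAverage g (h n) t := fun n a b hab =>
    monotone_leftAverage hg (hh n) (NNReal.coe_le_coe.2 hab)
  have htop : Tendsto g atTop atTop := y.2.2.2.comp tendsto_real_toNNReal_atTop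
  let ys : ℕ → CadlagUp := fun n =>
    ⟨⟨fun t => leftAverage g (h n) t, (hcont n).isCadlag⟩, hmono n,
      fun t => (y.2.2.1 _).trans (le_leftAverage hg (hh n) t),
      tendsto_atTop_mono (fun t : ℝ≥0 => le_leftAverage hg (hh n) (t : ℝ))
        (htop.comp (tendsto_atTop_add_const_right atTop (-h n)
          (NNReal.tendsto_coe_atTop.2 tendsto_id)))⟩
  refine ⟨ys, hcont, ?_⟩
  refine tendstoM1_of_monotone hmono (S := {t | ContinuousAt y.1.toFun t}) ?_ ?_ ?_
  · simpa [compl_def] using NNReal.dense_compl_of_countable y.2.1.countable_not_continuousAt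
  -- At time `0` right continuity is continuity.
  · have := (y.1.isCadlag 0).1
    have h0 : Ici (0 : ℝ≥0) = univ := Ici_bot
    rwa [h0, continuousWithinAt_univ] at this
  · intro t ht
    refine tendsto_of_tendsto_of_tendsto_of_le_of_le (g := fun n => g (t - h n))
      (h := fun _ => g t) ?_ ?_ (fun n => le_leftAverage hg (hh n) t)
      (fun n => leftAverage_le hg (hh n) t)
    · have h1 : Tendsto (fun n => ((t : ℝ) - h n).toNNReal) atTop (𝓝 t) := by
        have := (continuous_real_toNNReal.tendsto _).comp (hlim.const_sub (t : ℝ))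
        simpa [Function.comp_def] using this
      exact Tendsto.comp ht h1
    · rw [hgt]; exact tendsto_const_nhds

theorem propositionA1 (k : ℕ) (x : CadlagPath (EuclideanSpace ℝ (Fin k))) (y : CadlagUp)
    (hx : Continuous x.toFun) :
    ((∀ (xs : ℕ → CadlagPath (EuclideanSpace ℝ (Fin k))) (ys : ℕ → CadlagUp),
        TendstoM1 xs x → TendstoM1 (fun n => (ys n).1) y.1 →
          TendstoM1 (fun n => (xs n).comp (ys n)) (x.comp y)) ↔
      ∀ t ∈ y.1.disc, SegmentMonotoneOn x.toFun (jumpInterval y.1 t)) ∧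
    ∀ (xs : ℕ → CadlagPath (EuclideanSpace ℝ (Fin k))) (ys : ℕ → CadlagUp),
      TendstoM1 xs x → TendstoM1 (fun n => (ys n).1) y.1 →
      (∀ n, Continuous (ys n).1.toFun) →
      (TendstoM1 (fun n => (xs n).comp (ys n)) (x.comp y) ↔
        ∀ t ∈ y.1.disc, SegmentMonotoneOn x.toFun (jumpInterval y.1 t)) := by
  refine ⟨⟨fun h t _ => ?_, fun hmono xs ys hxs hys => tendstoM1_comp hx hxs hys hmono⟩,
    fun xs ys hxs hys hcont => ⟨fun h t _ => ?_, tendstoM1_comp hx hxs hys⟩⟩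
  -- The constant sequence `x` and continuous approximations of `y` suffice as test sequences.
  · obtain ⟨ys, hcont, hys⟩ := exists_continuous_tendstoM1 y
    exact segmentMonotoneOn_of_tendstoM1_comp hx (tendstoM1_const hx) hys hcont
      (h _ ys (tendstoM1_const hx) hys) t
  · exact segmentMonotoneOn_of_tendstoM1_comp hx hxs hys hcont h t
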